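/- Let $K$ be a field and let $A=\bigoplus_{i\ge 0}A_i$ be a commutative graded $K$-algebra with $A_0=K$ which is an algebra with straightening laws (ASL) on a finite poset $P\subset A$: the elements of $P$ are homogeneous of positive degree and generate $A$ as a $K$-algebra; the standard monomials $\alpha_1\alpha_2\cdots\alpha_t$ with $\alpha_1\le\alpha_2\le\dots\le\alpha_t$ in $P$, $t\ge 0$ (one for each multichain), form a $K$-basis of $A$; and for incomparable $\alpha,\beta\in P$ every standard monomial $\gamma_1\cdots\gamma_t$ (with $\gamma_1\le\dots\le\gamma_t$) occurring with non-zero coefficient in the expansion of $\alpha\beta$ in this basis has $t\ge 1$, $\gamma_1<\alpha$ and $\gamma_1<\beta$. Let $M=\bigoplus_{j\in\mathbb Z}M_j$ be a graded $A$-module which is a module with straightening laws (MSL) over $A$ on a finite non-empty poset $Q\subset M$ of homogeneous elements: for each $x\in Q$ there is a poset ideal (down-closed subset) $\mathcal I(x)\subset P$ such that the elements $\alpha_1\alpha_2\cdots\alpha_t x$ with $x\in Q$, $t\ge 0$, $\alpha_1\le\dots\le\alpha_t$ in $P$, and $\alpha_1\notin\mathcal I(x)$ if $t\ge1$, form a $K$-basis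 of $M$, and $\alpha x\in\sum_{y\in Q,\,y<x}Ay$ for all $x\in Q$ and $\alpha\in\mathcal I(x)$. Put $d=\max\{\deg p : p\in P\}$ (with $d=0$ if $P=\emptyset$) and $m=\max\{\deg q: q\in Q\}$, and regard $K=A/\bigoplus_{i>0}A_i$ as a graded $A$-module concentrated in degree $0$. Then the graded Betti numbers $\beta_{i,j}(M)=\dim_K\operatorname{Tor}_i^A(M,K)_j$ satisfy $$\beta_{i,j}(M)=0\qquad\text{for all integers } i\ge 0 \text{ and } j \text{ with } j-i\ge i(d-1)+m+1 .$$ -/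

import Mathlib

open scoped TensorProduct

universe u v w

/-! ### Algebras and modules with straightening laws

A finite poset contained in an algebra (or a module) is given by a finite partially ordered type
together with a map; the basis axioms below force that map to be injective. -/

/-- Multichains `α₁ ≤ α₂ ≤ ⋯ ≤ αₜ` (`t ≥ 0`) of a poset. -/
abbrev Multichain (P : Type*) [PartialOrder P] : Type _ :=
  {l : List P // l.Pairwise (· ≤ ·)}

/-- The standard monomial `α₁ α₂ ⋯ αₜ` of a multichain; the empty multichain gives `1`. -/
def stdMonomial {A P : Type*} [CommRing A] [PartialOrder P] (φ : P → A) (c : Multichain P) : A :=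
  (c.1.map φ).prod

/-- `A` is a (graded) algebra with straightening laws on the finite poset `P` over `K`. -/
structure IsASL {K A P : Type*} [Field K] [CommRing A] [Algebra K A] (𝒜 : ℕ → Submodule K A)
    [GradedAlgebra 𝒜] [PartialOrder P] [Finite P] (φ : P → A) : Prop where
  /-- `A₀ = K` -/
  zero_part : 𝒜 0 = 1
  /-- the elements of `P` are homogeneous of positive degree -/
  homogeneous : ∀ p, ∃ n, 0 < n ∧ φ p ∈ 𝒜 n
  /-- `P` generates `A` as a `K`-algebra -/
  generates : Algebra.adjoin K (Set.range φ) = ⊤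
  /-- the standard monomials form a `K`-basis -/
  linearIndependent : LinearIndependent K (stdMonomial φ)
  span_eq_top : Submodule.span K (Set.range (stdMonomial φ)) = ⊤
  /-- straightening laws: for incomparable `α`, `β`, every standard monomial `γ₁ γ₂ ⋯ γₜ` in the
  representation of `α β` has `t ≥ 1`, `γ₁ < α` and `γ₁ < β` -/
  straightening : ∀ α β : P, ¬ α ≤ β → ¬ β ≤ α → ∀ r : Multichain P →₀ K,
    φ α * φ β = Finsupp.linearCombination K (stdMonomial φ) r →
      ∀ c ∈ r.support, ∃ γ, c.1.head? = some γ ∧ γ < α ∧ γ < β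

/-- Index set of the standard elements `α₁ α₂ ⋯ αₜ x`: pairs of an element `x` of `Q` and a
multichain whose first element (if there is one) is not in `I x`. -/
abbrev StdIndex {P Q : Type*} [PartialOrder P] (I : Q → LowerSet P) : Type _ :=
  {z : Q × Multichain P // ∀ α, z.2.1.head? = some α → α ∉ I z.1}

/-- The standard element `α₁ α₂ ⋯ αₜ x`. -/
def stdElement {A M P Q : Type*} [CommRing A] [AddCommGroup M] [Module A M] [PartialOrder P]
    (φ : P → A) (ψ : Q → M) (I : Q → LowerSet P) (z : StdIndex I) : M :=
  stdMonomial φ z.1.2 • ψ z.1.1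

/-- `M` is a module with straightening laws on the finite poset `Q` over `A`, where
`φ : P → A` is the poset of the algebra with straightening laws `A`. -/
structure IsMSL (K : Type*) {A M P Q : Type*} [Field K] [CommRing A] [AddCommGroup M]
    [Module K M] [Module A M] [PartialOrder P] [PartialOrder Q] [Finite Q]
    (φ : P → A) (ψ : Q → M) : Prop where
  exists_ideals : ∃ I : Q → LowerSet P,
    LinearIndependent K (stdElement φ ψ I) ∧
    Submodule.span K (Set.range (stdElement φ ψ I)) = ⊤ ∧
    ∀ x : Q, ∀ α ∈ I x, φ α • ψ x ∈ Submodule.span A (ψ '' {y | y < x})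

/-! ### Graded Tor and graded Betti numbers -/

section GradedTor

variable {K : Type*} {A : Type u} [Field K] [CommRing A] [Algebra K A]

/-- The grading `𝒜` indexed by `ℤ`, with `A_n = 0` for `n < 0`. -/
def intPart (𝒜 : ℕ → Submodule K A) : ℤ → Submodule K A
  | Int.ofNat n => 𝒜 n
  | Int.negSucc _ => ⊥

/-- The component of degree `n` of the graded free module `⨁ₛ A(-deg s)`, the free module on a
basis in which the basis element `s` has degree `deg s`. -/
def freePart (𝒜 : ℕ → Submodule K A) {ι : Type w} (deg : ι → ℤ) (n : ℤ) :
    Submodule K (ι →₀ A) where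
  carrier := {f | ∀ s, f s ∈ intPart 𝒜 (n - deg s)}
  add_mem' hf hg s := add_mem (hf s) (hg s)
  zero_mem' _ := zero_mem _
  smul_mem' c _ hf s := Submodule.smul_mem _ c (hf s)

/-- The residue module `K = A / A₊` of `A`, concentrated in degree `0`. -/
abbrev ResidueModule (𝒜 : ℕ → Submodule K A) [GradedAlgebra 𝒜] : Type u :=
  A ⧸ (HomogeneousIdeal.irrelevant 𝒜).toIdeal

/-- A graded free resolution `⋯ → G₂ → G₁ → G₀ → K → 0` of `K = A / A₊` over `A`, where
`Gᵢ = ⨁ₛ A(-deg i s)` and all maps are homogeneous of degree `0`. -/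
structure GradedFreeResolution (𝒜 : ℕ → Submodule K A) [GradedAlgebra 𝒜] where
  ι : ℕ → Type w
  deg : ∀ i, ι i → ℤ
  d : ∀ i, (ι (i + 1) →₀ A) →ₗ[A] (ι i →₀ A)
  aug : (ι 0 →₀ A) →ₗ[A] ResidueModule 𝒜
  d_homogeneous : ∀ i s, d i (Finsupp.single s 1) ∈ freePart 𝒜 (deg i) (deg (i + 1) s)
  aug_homogeneous : ∀ s, deg 0 s ≠ 0 → aug (Finsupp.single s 1) = 0
  exact_d : ∀ i, Function.Exact (d (i + 1)) (d i)
  exact_aug : Function.Exact (d 0) aug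
  aug_surjective : Function.Surjective aug

/-! #### Existence of graded free resolutions -/

section Existence

variable (𝒜 : ℕ → Submodule K A) [GradedAlgebra 𝒜]

/-- The projection of `A` onto its component of degree `n : ℤ`. -/
noncomputable def projZ : ℤ → A →ₗ[K] A
  | Int.ofNat n => GradedAlgebra.proj 𝒜 n
  | Int.negSucc _ => 0

theorem projZ_mem (n : ℤ) (a : A) : projZ 𝒜 n a ∈ intPart 𝒜 n := by
  cases n with
  | ofNat n => exact SetLike.coe_mem _
  | negSucc n => exact zero_mem _

theorem projZ_same {n : ℤ} {a : A} (h : a ∈ intPart 𝒜 n) : projZ 𝒜 n a = a := by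
  cases n with
  | ofNat n => exact DirectSum.decompose_of_mem_same 𝒜 h
  | negSucc n => exact ((Submodule.mem_bot K).1 h).symm

theorem projZ_ne {n e : ℤ} {a : A} (h : a ∈ intPart 𝒜 e) (hne : e ≠ n) :
    projZ 𝒜 n a = 0 := by
  cases e with
  | ofNat e =>
    cases n with
    | ofNat n =>
      exact DirectSum.decompose_of_mem_ne 𝒜 h (fun h' => hne (by rw [h']))
    | negSucc n => rfl
  | negSucc e =>
    rw [(Submodule.mem_bot K).1 h, map_zero]

theorem mul_mem_intPart {k : ℕ} {e : ℤ} {a b : A} (ha : a ∈ 𝒜 k) (hb : b ∈ intPart 𝒜 e) :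
    a * b ∈ intPart 𝒜 (k + e) := by
  cases e with
  | ofNat e =>
    have h : a * b ∈ 𝒜 (k + e) := SetLike.mul_mem_graded ha hb
    exact h
  | negSucc e => rw [(Submodule.mem_bot K).1 hb, mul_zero]; exact zero_mem _

/-- The projection of a graded free module onto its component of degree `n`. -/
noncomputable def freeProj {ι : Type w} (deg : ι → ℤ) (n : ℤ) : (ι →₀ A) →ₗ[K] (ι →₀ A) :=
  Finsupp.lsum K fun s => (Finsupp.lsingle s).comp (projZ 𝒜 (n - deg s))

theorem freeProj_apply {ι : Type w} (deg : ι → ℤ) (n : ℤ) (f : ι →₀ A) (s : ι) :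
    freeProj 𝒜 deg n f s = projZ 𝒜 (n - deg s) (f s) := by
  classical
  induction f using Finsupp.induction_linear with
  | zero => simp
  | add f g hf hg => simp only [map_add, Finsupp.add_apply, hf, hg]
  | single t a =>
    by_cases h : t = s
    · subst h; simp [freeProj]
    · simp [freeProj, h]

theorem freeProj_mem {ι : Type w} (deg : ι → ℤ) (n : ℤ) (f : ι →₀ A) :
    freeProj 𝒜 deg n f ∈ freePart 𝒜 deg n := fun s => by
  rw [freeProj_apply]; exact projZ_mem 𝒜 _ _

theorem freeProj_same {ι : Type w} {deg : ι → ℤ} {n : ℤ} {f : ι →₀ A}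
    (h : f ∈ freePart 𝒜 deg n) : freeProj 𝒜 deg n f = f := by
  ext s; rw [freeProj_apply]; exact projZ_same 𝒜 (h s)

theorem freeProj_ne {ι : Type w} {deg : ι → ℤ} {n e : ℤ} {f : ι →₀ A}
    (h : f ∈ freePart 𝒜 deg e) (hne : e ≠ n) : freeProj 𝒜 deg n f = 0 := by
  ext s; rw [freeProj_apply]; exact projZ_ne 𝒜 (h s) (by omega)

theorem smul_mem_freePart {ι : Type w} {deg : ι → ℤ} {e : ℤ} {k : ℕ} {a : A} {f : ι →₀ A}
    (ha : a ∈ 𝒜 k) (h : f ∈ freePart 𝒜 deg e) : a • f ∈ freePart 𝒜 deg (k + e) := fun s => by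
  have := mul_mem_intPart 𝒜 ha (h s)
  rwa [← add_sub_assoc] at this

theorem single_mem_freePart {ι : Type w} (deg : ι → ℤ) {k : ℕ} {a : A} (s : ι)
    (ha : a ∈ 𝒜 k) : Finsupp.single s a ∈ freePart 𝒜 deg (k + deg s) := fun t => by
  classical
  by_cases h : s = t
  · subst h
    rw [Finsupp.single_eq_same, add_sub_cancel_right]
    exact ha
  · rw [Finsupp.single_eq_of_ne' h]; exact zero_mem _

/-- Induction on elements of a graded free module. -/
theorem freeInduction {ι : Type w} {p : (ι →₀ A) → Prop} (h0 : p 0)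
    (hadd : ∀ f g, p f → p g → p (f + g))
    (hs : ∀ (s : ι) (k : ℕ) (a : A), a ∈ 𝒜 k → p (Finsupp.single s a)) (f : ι →₀ A) : p f := by
  induction f using Finsupp.induction_linear with
  | zero => exact h0
  | add f g hf hg => exact hadd f g hf hg
  | single t a =>
    induction a using DirectSum.Decomposition.inductionOn 𝒜 with
    | zero => simpa using h0
    | homogeneous a => exact hs t _ a a.2
    | add a b ha hb => rw [Finsupp.single_add]; exact hadd _ _ ha hb

theorem exists_sum_freeProj {ι : Type w} (deg : ι → ℤ) (f : ι →₀ A) :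
    ∃ T₀ : Finset ℤ, ∀ T, T₀ ⊆ T → ∑ n ∈ T, freeProj 𝒜 deg n f = f := by
  classical
  induction f using freeInduction 𝒜 with
  | h0 => exact ⟨∅, fun T _ => by simp⟩
  | hadd f g hf hg =>
    obtain ⟨S, hS⟩ := hf
    obtain ⟨T, hT⟩ := hg
    refine ⟨S ∪ T, fun U hU => ?_⟩
    simp only [map_add, Finset.sum_add_distrib]
    rw [hS U (Finset.union_subset_left hU), hT U (Finset.union_subset_right hU)]
  | hs s k a ha =>
    have h := single_mem_freePart 𝒜 deg s ha
    refine ⟨{k + deg s}, fun T hT => ?_⟩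
    rw [Finset.sum_eq_single_of_mem _ (hT (Finset.mem_singleton_self _))
      (fun n _ hn => freeProj_ne 𝒜 h hn.symm), freeProj_same 𝒜 h]

/-- A graded free module together with a graded submodule. -/
structure GradedSub where
  ι : Type u
  deg : ι → ℤ
  N : Submodule A (ι →₀ A)
  graded : ∀ f ∈ N, ∀ n, freeProj 𝒜 deg n f ∈ N

variable {𝒜}

namespace GradedSub

/-- Basis of a graded free cover of a graded submodule: its homogeneous elements. -/
abbrev Gen (S : GradedSub.{u} 𝒜) : Type u :=
  {p : ℤ × (S.ι →₀ A) // p.2 ∈ S.N ∧ p.2 ∈ freePart 𝒜 S.deg p.1}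

/-- The graded free cover of a graded submodule. -/
noncomputable def cover (S : GradedSub.{u} 𝒜) : (S.Gen →₀ A) →ₗ[A] (S.ι →₀ A) :=
  Finsupp.linearCombination A fun p => p.1.2

theorem cover_single (S : GradedSub.{u} 𝒜) (s : S.Gen) (a : A) :
    S.cover (Finsupp.single s a) = a • s.1.2 :=
  Finsupp.linearCombination_single A a s

theorem cover_freeProj (S : GradedSub.{u} 𝒜) (n : ℤ) (f : S.Gen →₀ A) :
    S.cover (freeProj 𝒜 (fun p => p.1.1) n f) = freeProj 𝒜 S.deg n (S.cover f) := by
  induction f using freeInduction 𝒜 with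
  | h0 => simp
  | hadd f g hf hg => simp only [map_add, hf, hg]
  | hs s k a ha =>
    have h := single_mem_freePart 𝒜 (fun p : S.Gen => p.1.1) s ha
    have h' := smul_mem_freePart 𝒜 ha s.2.2
    by_cases hn : (k : ℤ) + s.1.1 = n
    · subst hn
      rw [freeProj_same 𝒜 h, cover_single, freeProj_same 𝒜 h']
    · rw [freeProj_ne 𝒜 h hn, cover_single, freeProj_ne 𝒜 h' hn, map_zero]

theorem range_cover (S : GradedSub.{u} 𝒜) : LinearMap.range S.cover = S.N := by
  unfold cover
  rw [Finsupp.range_linearCombination]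
  apply le_antisymm
  · rw [Submodule.span_le]
    rintro _ ⟨p, rfl⟩
    exact p.2.1
  · intro f hf
    obtain ⟨T, hT⟩ := exists_sum_freeProj 𝒜 S.deg f
    rw [← hT T subset_rfl]
    exact Submodule.sum_mem _ fun n _ =>
      Submodule.subset_span ⟨⟨(n, _), S.graded f hf n, freeProj_mem 𝒜 S.deg n f⟩, rfl⟩

/-- The first syzygies. -/
noncomputable def next (S : GradedSub.{u} 𝒜) : GradedSub.{u} 𝒜 where
  ι := S.Gen
  deg p := p.1.1
  N := LinearMap.ker S.cover
  graded f hf n := by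
    rw [LinearMap.mem_ker] at hf ⊢
    rw [cover_freeProj, hf, map_zero]

theorem exact_next (S : GradedSub.{u} 𝒜) : Function.Exact S.next.cover S.cover :=
  LinearMap.exact_iff.2 S.next.range_cover.symm

theorem cover_homogeneous (S : GradedSub.{u} 𝒜) (s : S.Gen) :
    S.cover (Finsupp.single s 1) ∈ freePart 𝒜 S.deg s.1.1 := by
  rw [cover_single, one_smul]
  exact s.2.2

end GradedSub

variable (𝒜)

/-- `A → K`. -/
noncomputable def baseAug : (PUnit.{u + 1} →₀ A) →ₗ[A] ResidueModule 𝒜 :=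
  (Submodule.mkQ (HomogeneousIdeal.irrelevant 𝒜).toIdeal).comp (Finsupp.lapply PUnit.unit)

/-- The submodule `A₊` of `A`. -/
noncomputable def baseSub : GradedSub.{u} 𝒜 where
  ι := PUnit
  deg _ := 0
  N := LinearMap.ker (baseAug 𝒜)
  graded f hf n := by
    have key : ∀ g : PUnit.{u + 1} →₀ A, g ∈ LinearMap.ker (baseAug 𝒜) ↔
        g PUnit.unit ∈ HomogeneousIdeal.irrelevant 𝒜 := fun g =>
      Submodule.Quotient.mk_eq_zero _
    rw [key] at hf ⊢
    rw [freeProj_apply, sub_zero]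
    cases n with
    | ofNat n => exact (HomogeneousIdeal.irrelevant 𝒜).isHomogeneous n hf
    | negSucc n => exact zero_mem _

theorem baseAug_surjective : Function.Surjective (baseAug 𝒜) :=
  (Submodule.mkQ_surjective _).comp fun a => ⟨Finsupp.single PUnit.unit a, by simp⟩

theorem baseSub_exact : Function.Exact (baseSub 𝒜).cover (baseAug 𝒜) :=
  LinearMap.exact_iff.2 (baseSub 𝒜).range_cover.symm

/-- Iterated syzygies of `K`. -/
noncomputable def syz : ℕ → GradedSub.{u} 𝒜
  | 0 => baseSub 𝒜
  | i + 1 => (syz i).next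

/-- Every graded algebra has a graded free resolution of its residue module. -/
theorem nonempty_gradedFreeResolution : Nonempty (GradedFreeResolution.{u, u} 𝒜) :=
  ⟨{ ι := fun i => (syz 𝒜 i).ι
     deg := fun i => (syz 𝒜 i).deg
     d := fun i => (syz 𝒜 i).cover
     aug := baseAug 𝒜
     d_homogeneous := fun i s => (syz 𝒜 i).cover_homogeneous s
     aug_homogeneous := fun _ hs => absurd rfl hs
     exact_d := fun i => (syz 𝒜 i).exact_next
     exact_aug := baseSub_exact 𝒜
     aug_surjective := baseAug_surjective 𝒜 }⟩

end Existence

namespace GradedFreeResolution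

variable {𝒜 : ℕ → Submodule K A} [GradedAlgebra 𝒜]
variable {M : Type v} [AddCommGroup M] [Module K M] [Module A M] [IsScalarTower K A M]

/-- The component of degree `j` of the graded module `M ⊗_A Gᵢ`. -/
noncomputable def tensorPart (G : GradedFreeResolution.{u, w} 𝒜) (ℳ : ℤ → Submodule K M) (i : ℕ) (j : ℤ) :
    Submodule K (M ⊗[A] (G.ι i →₀ A)) :=
  Submodule.span K {t | ∃ a b : ℤ, a + b = j ∧
    ∃ x ∈ ℳ a, ∃ g ∈ freePart 𝒜 (G.deg i) b, t = x ⊗ₜ[A] g}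

/-- The differential `M ⊗_A Gᵢ₊₁ → M ⊗_A Gᵢ`. -/
noncomputable def tensorD (G : GradedFreeResolution.{u, w} 𝒜) (M : Type v) [AddCommGroup M] [Module K M]
    [Module A M] [IsScalarTower K A M] (i : ℕ) :
    (M ⊗[A] (G.ι (i + 1) →₀ A)) →ₗ[K] (M ⊗[A] (G.ι i →₀ A)) :=
  ((G.d i).lTensor M).restrictScalars K

/-- The `i`-cycles of `M ⊗_A G`. -/
noncomputable def cycles (G : GradedFreeResolution.{u, w} 𝒜) (M : Type v) [AddCommGroup M] [Module K M]
    [Module A M] [IsScalarTower K A M] : (i : ℕ) → Submodule K (M ⊗[A] (G.ι i →₀ A))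
  | 0 => ⊤
  | i + 1 => LinearMap.ker (G.tensorD M i)

/-- `Tor_i^A(M, K)_j`: the `i`-th homology of the degree `j` strand of `M ⊗_A G`. -/
abbrev Tor (G : GradedFreeResolution.{u, w} 𝒜) (ℳ : ℤ → Submodule K M) (i : ℕ) (j : ℤ) :
    Type _ :=
  ↥(G.cycles M i ⊓ G.tensorPart ℳ i j) ⧸
    ((G.tensorPart ℳ (i + 1) j).map (G.tensorD M i)).comap
      (G.cycles M i ⊓ G.tensorPart ℳ i j).subtype

/-- The graded Betti number `β_{i,j}(M) = dim_K Tor_i^A(M, K)_j`. -/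
noncomputable def betti (G : GradedFreeResolution.{u, w} 𝒜) (ℳ : ℤ → Submodule K M)
    (i : ℕ) (j : ℤ) : Cardinal :=
  Module.rank K (G.Tor ℳ i j)

end GradedFreeResolution

end GradedTor

/-! The submodules of `M` generated by lower sets of `Q` form a filtration with cyclic quotients. If
`x` is added to a lower set that contains everything below `x`, the new quotient is `A/J` shifted by
the degree of `x`, where `J` is generated by the poset ideal of `x`: straightening shows that `J`
kills `x` modulo the earlier generators, and the basis property shows that nothing else does
(`smul_mem_span_iff`). Hence, if every `Tor_i(A/J, K)` with `J` generated by a poset ideal vanishes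
above degree `b`, then `Tor_i(M, K)` vanishes above `b + m` (`vanishAbove_sup_span`,
`IsStraightened.vanishAbove`).

It remains to get `b = i * d`. The ideal `J` is itself a straightened module on its poset of
generators, of degrees at most `d` (`isStraightened_lowerSet`), so the same filtration bounds
`Tor_i(J, K)`. The injection of `Tor_{i+1}(A/J, K)` into `Tor_i(J, K)` (`vanishAbove_top_succ`) then
raises `i` by one at the cost of `d`. The induction starts from `Tor_0(A/J, K)`, a quotient of `K`.

Both exact-sequence arguments are carried out on cycles and boundaries, with elements of `M ⊗ Gᵢ`
read as finitely supported vectors over `M`. -/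

section GradedModule

/-! ### Projections onto homogeneous components. -/

variable {K : Type*} {A : Type u} [Field K] [CommRing A] [Algebra K A]
variable {M : Type v} [AddCommGroup M] [Module K M] [Module A M]

/-- The maps `pr n` are the projections onto the components of a graded `A`-module `M`. -/
structure IsGradedProj (𝒜 : ℕ → Submodule K A) (ℳ : ℤ → Submodule K M) (pr : ℤ → M →ₗ[K] M) :
    Prop where
  mem : ∀ n x, pr n x ∈ ℳ n
  same : ∀ n, ∀ x ∈ ℳ n, pr n x = x
  ne : ∀ n e, ∀ x ∈ ℳ e, e ≠ n → pr n x = 0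
  smul_mem : ∀ (a : ℕ) (b : ℤ), ∀ r ∈ 𝒜 a, ∀ x ∈ ℳ b, r • x ∈ ℳ (a + b)

namespace IsGradedProj

variable {𝒜 : ℕ → Submodule K A} {ℳ : ℤ → Submodule K M} {pr : ℤ → M →ₗ[K] M}

theorem smul_mem_of_intPart (h : IsGradedProj 𝒜 ℳ pr) {a b : ℤ} {r : A} {x : M}
    (hr : r ∈ intPart 𝒜 a) (hx : x ∈ ℳ b) : r • x ∈ ℳ (a + b) := by
  cases a with
  | ofNat a => exact h.smul_mem a b r hr x hx
  | negSucc a => rw [(Submodule.mem_bot K).1 hr, zero_smul]; exact zero_mem _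

theorem proj_smul [GradedAlgebra 𝒜] (h : IsGradedProj 𝒜 ℳ pr) {b : ℤ} {x : M} (hx : x ∈ ℳ b)
    (e : ℤ) (a : A) : pr e (a • x) = projZ 𝒜 (e - b) a • x := by
  induction a using DirectSum.Decomposition.inductionOn 𝒜 with
  | zero => simp
  | @homogeneous k a =>
    have ha : (a : A) ∈ intPart 𝒜 (k : ℤ) := a.2
    have hax := h.smul_mem k b a a.2 x hx
    by_cases he : (k : ℤ) + b = e
    · subst he
      rw [h.same _ _ hax, add_sub_cancel_right, projZ_same 𝒜 ha]
    · rw [h.ne _ _ _ hax he, projZ_ne 𝒜 ha (by omega), zero_smul]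
  | add a b ha hb => simp only [add_smul, map_add, ha, hb]

/-- A submodule generated by homogeneous elements is graded. -/
theorem proj_mem_span [GradedAlgebra 𝒜] (h : IsGradedProj 𝒜 ℳ pr) {S : Set M}
    (hS : ∀ x ∈ S, ∃ b, x ∈ ℳ b) (e : ℤ) {u : M} (hu : u ∈ Submodule.span A S) :
    pr e u ∈ Submodule.span A S := by
  -- `pr e` is not `A`-linear, so the scalar case of the induction needs the claim for all multiples
  -- of `u`.
  suffices H : ∀ a : A, pr e (a • u) ∈ Submodule.span A S by simpa using H 1
  induction hu using Submodule.span_induction with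
  | mem x hx =>
    intro a
    obtain ⟨b, hb⟩ := hS x hx
    rw [h.proj_smul hb]
    exact Submodule.smul_mem _ _ (Submodule.subset_span hx)
  | zero => simp
  | add x y _ _ hx hy => intro a; rw [smul_add, map_add]; exact add_mem (hx a) (hy a)
  | smul r x _ hx => intro a; rw [smul_smul]; exact hx _

end IsGradedProj

theorem isGradedProj_projZ (𝒜 : ℕ → Submodule K A) [GradedAlgebra 𝒜] :
    IsGradedProj 𝒜 (intPart 𝒜) (projZ 𝒜) where
  mem := projZ_mem 𝒜
  same _ _ h := projZ_same 𝒜 h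
  ne _ _ _ h hne := projZ_ne 𝒜 h hne
  smul_mem _ _ _ hr _ hx := mul_mem_intPart 𝒜 hr hx

theorem exists_isGradedProj {𝒜 : ℕ → Submodule K A} (ℳ : ℤ → Submodule K M)
    [DirectSum.Decomposition ℳ]
    (hℳ : ∀ (a : ℕ) (b : ℤ), ∀ r ∈ 𝒜 a, ∀ x ∈ ℳ b, r • x ∈ ℳ (a + b)) :
    ∃ pr, IsGradedProj 𝒜 ℳ pr :=
  ⟨fun n => (ℳ n).subtype ∘ₗ DirectSum.component K ℤ (fun i => ℳ i) n ∘ₗ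
      (DirectSum.decomposeLinearEquiv ℳ).toLinearMap,
    { mem := fun _ _ => SetLike.coe_mem _
      same := fun _ _ hx => DirectSum.decompose_of_mem_same ℳ hx
      ne := fun _ _ _ hx hne => DirectSum.decompose_of_mem_ne ℳ hx hne
      smul_mem := hℳ }⟩

end GradedModule

/-! ### The complex `M ⊗ G` as vectors over `M`. -/

section Strands

variable {K : Type*} {A : Type u} [Field K] [CommRing A] [Algebra K A]
variable {𝒜 : ℕ → Submodule K A} [GradedAlgebra 𝒜]
variable {M : Type v} [AddCommGroup M] [Module K M] [Module A M]

/-- The vector of multiples of `x` with coefficients `v`. -/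
noncomputable def Finsupp.smulVec {ι : Type*} (x : M) : (ι →₀ A) →ₗ[A] (ι →₀ M) :=
  Finsupp.mapRange.linearMap (LinearMap.toSpanSingleton A M x)

@[simp] theorem Finsupp.smulVec_apply {ι : Type*} (x : M) (v : ι →₀ A) (s : ι) :
    Finsupp.smulVec x v s = v s • x := by
  simp [Finsupp.smulVec]

theorem Finsupp.smulVec_single {ι : Type*} (x : M) (s : ι) :
    Finsupp.smulVec x (Finsupp.single s (1 : A)) = Finsupp.single s x := by
  simp [Finsupp.smulVec]

theorem Finsupp.smulVec_one {ι : Type*} (v : ι →₀ A) : Finsupp.smulVec (1 : A) v = v := by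
  ext s; simp

/-- The identification of `M ⊗ F` with vectors over `M`, for `F` free. -/
noncomputable def tensorVec (A : Type u) [CommRing A] (M : Type v) [AddCommGroup M] [Module A M]
    (ι : Type w) : (M ⊗[A] (ι →₀ A)) ≃ₗ[A] (ι →₀ M) :=
  letI := Classical.decEq ι
  TensorProduct.finsuppScalarRight A A M ι

theorem tensorVec_tmul {ι : Type w} (x : M) (v : ι →₀ A) :
    tensorVec A M ι (x ⊗ₜ v) = Finsupp.smulVec x v := by
  classical
  ext s
  simp [tensorVec, TensorProduct.finsuppScalarRight_apply_tmul_apply]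

theorem tensorVec_symm_single {ι : Type w} (s : ι) (x : M) :
    (tensorVec A M ι).symm (Finsupp.single s x) = x ⊗ₜ Finsupp.single s 1 := by
  rw [LinearEquiv.symm_apply_eq, tensorVec_tmul, Finsupp.smulVec_single]

theorem freeProj_map {ι ι' : Type*} {deg : ι → ℤ} {deg' : ι' → ℤ} (f : (ι' →₀ A) →ₗ[A] (ι →₀ A))
    (hf : ∀ s, f (Finsupp.single s 1) ∈ freePart 𝒜 deg (deg' s)) (n : ℤ) (v : ι' →₀ A) :
    f (freeProj 𝒜 deg' n v) = freeProj 𝒜 deg n (f v) := by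
  induction v using freeInduction 𝒜 with
  | h0 => simp
  | hadd f g hf hg => simp only [map_add, hf, hg]
  | hs s k a ha =>
    have h := single_mem_freePart 𝒜 deg' s ha
    have h' := smul_mem_freePart 𝒜 ha (hf s)
    have hs : f (Finsupp.single s a) = a • f (Finsupp.single s 1) := by
      rw [← map_smul, Finsupp.smul_single_one]
    by_cases hn : (k : ℤ) + deg' s = n
    · subst hn
      rw [freeProj_same 𝒜 h, hs, freeProj_same 𝒜 h']
    · rw [freeProj_ne 𝒜 h hn, hs, freeProj_ne 𝒜 h' hn, map_zero]

set_option linter.unusedSectionVars false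

namespace GradedFreeResolution

variable (G : GradedFreeResolution.{u, w} 𝒜)

/-- The differential of `M ⊗ G` on vectors over `M`. -/
noncomputable def vecD (M : Type v) [AddCommGroup M] [Module A M] (i : ℕ) :
    (G.ι (i + 1) →₀ M) →ₗ[A] (G.ι i →₀ M) :=
  (tensorVec A M _).toLinearMap ∘ₗ (G.d i).lTensor M ∘ₗ (tensorVec A M _).symm.toLinearMap

theorem vecD_tensorVec (i : ℕ) (t : M ⊗[A] (G.ι (i + 1) →₀ A)) :
    G.vecD M i (tensorVec A M _ t) = tensorVec A M _ ((G.d i).lTensor M t) := by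
  simp [vecD]

theorem vecD_smulVec (i : ℕ) (x : M) (v : G.ι (i + 1) →₀ A) :
    G.vecD M i (Finsupp.smulVec x v) = Finsupp.smulVec x (G.d i v) := by
  rw [← tensorVec_tmul, vecD_tensorVec, LinearMap.lTensor_tmul, tensorVec_tmul]

theorem vecD_self (i : ℕ) : G.vecD A i = G.d i := by
  ext1 s
  ext1
  simp only [LinearMap.comp_apply, Finsupp.lsingle_apply]
  rw [← Finsupp.smulVec_one (Finsupp.single s (1 : A)), vecD_smulVec, Finsupp.smulVec_one,
    Finsupp.smulVec_one]

theorem d_comp_d (i : ℕ) (v : G.ι (i + 2) →₀ A) : G.d i (G.d (i + 1) v) = 0 :=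
  (G.exact_d i _).2 ⟨v, rfl⟩

theorem vecD_vecD (i : ℕ) (f : G.ι (i + 2) →₀ M) : G.vecD M i (G.vecD M (i + 1) f) = 0 := by
  induction f using Finsupp.induction_linear with
  | zero => simp
  | add f g hf hg => rw [map_add, map_add, hf, hg, add_zero]
  | single s x =>
    rw [← Finsupp.smulVec_single (A := A), vecD_smulVec, vecD_smulVec, d_comp_d, map_zero]

/-- Each entry of the differential is a finite sum of matrix coefficients times entries of `f`.
Letting `W` depend on `t` covers both membership in a submodule and homogeneity. -/
theorem vecD_induction (i : ℕ) (W : G.ι i → AddSubgroup M) (f : G.ι (i + 1) →₀ M)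
    (h : ∀ s t, G.d i (Finsupp.single s 1) t • f s ∈ W t) (t : G.ι i) : G.vecD M i f t ∈ W t := by
  have : G.vecD M i f t = f.sum fun s x => G.d i (Finsupp.single s 1) t • x := by
    conv_lhs => rw [← f.sum_single]
    rw [map_finsuppSum, Finsupp.sum_apply]
    refine Finsupp.sum_congr fun s _ => ?_
    rw [← Finsupp.smulVec_single (A := A), vecD_smulVec, Finsupp.smulVec_apply]
  rw [this]
  exact sum_mem fun s _ => h s t

theorem vecD_mem {N : Submodule A M} {i : ℕ} {f : G.ι (i + 1) →₀ M} (hf : ∀ s, f s ∈ N)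
    (t : G.ι i) : G.vecD M i f t ∈ N :=
  G.vecD_induction i (fun _ => N.toAddSubgroup) f (fun s _ => N.smul_mem _ (hf s)) t

/-- `f` is a vector over `M` which is homogeneous of degree `j`. -/
def HomVec (ℳ : ℤ → Submodule K M) (i : ℕ) (j : ℤ) (f : G.ι i →₀ M) : Prop :=
  ∀ s, f s ∈ ℳ (j - G.deg i s)

theorem homVec_vecD {ℳ : ℤ → Submodule K M} {pr : ℤ → M →ₗ[K] M} (h : IsGradedProj 𝒜 ℳ pr)
    {i : ℕ} {j : ℤ} {f : G.ι (i + 1) →₀ M} (hf : G.HomVec ℳ (i + 1) j f) :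
    G.HomVec ℳ i j (G.vecD M i f) :=
  G.vecD_induction i (fun t => (ℳ (j - G.deg i t)).toAddSubgroup) f fun s t => by
    have := h.smul_mem_of_intPart (G.d_homogeneous i s t) (hf s)
    rwa [show G.deg (i + 1) s - G.deg i t + (j - G.deg (i + 1) s) = j - G.deg i t by ring] at this

/-- `f` is a cycle modulo `N`. -/
def CycleMod (N : Submodule A M) : (i : ℕ) → (G.ι i →₀ M) → Prop
  | 0, _ => True
  | i + 1, f => ∀ s, G.vecD M i f s ∈ N

theorem CycleMod.sub_vecD {N : Submodule A M} {i : ℕ} {f : G.ι i →₀ M} (hf : G.CycleMod N i f)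
    (g : G.ι (i + 1) →₀ M) : G.CycleMod N i (f - G.vecD M i g) := by
  cases i with
  | zero => trivial
  | succ i =>
    intro s
    rw [map_sub, vecD_vecD, sub_zero]
    exact hf s

/-! ### Vanishing of Tor: degree zero, dimension shift, extensions. -/

/-- For `N ≤ L` this says that `Tor_i(L / N, K)` vanishes in all degrees greater than `b`. -/
def VanishAbove (ℳ : ℤ → Submodule K M) (N L : Submodule A M) (i : ℕ) (b : ℤ) : Prop :=
  ∀ j, b < j → ∀ f, (∀ s, f s ∈ L) → G.HomVec ℳ i j f → G.CycleMod N i f →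
    ∃ g : G.ι (i + 1) →₀ M, (∀ s, g s ∈ L) ∧ G.HomVec ℳ (i + 1) j g ∧
      ∀ s, (f - G.vecD M i g) s ∈ N

/-- A basis element of nonzero degree is killed by `aug`; one of degree `0` has its coefficient in
`A_j`, which annihilates `K` because `j > 0`. -/
theorem aug_eq_zero {j : ℤ} (hj : 0 < j) {f : G.ι 0 →₀ A} (hf : G.HomVec (intPart 𝒜) 0 j f) :
    G.aug f = 0 := by
  rw [← f.sum_single, map_finsuppSum]
  refine Finset.sum_eq_zero fun s _ => ?_
  change G.aug (Finsupp.single s (f s)) = 0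
  rw [← Finsupp.smul_single_one, map_smul]
  by_cases hs : G.deg 0 s = 0
  · have hfs := hf s
    rw [hs, sub_zero] at hfs
    obtain ⟨n, rfl⟩ := Int.eq_ofNat_of_zero_le hj.le
    have hmem : f s ∈ HomogeneousIdeal.irrelevant 𝒜 := by
      rw [HomogeneousIdeal.mem_irrelevant_iff, GradedRing.proj_apply]
      exact DirectSum.decompose_of_mem_ne 𝒜 (i := n) hfs (by omega)
    obtain ⟨y, hy⟩ := Submodule.mkQ_surjective _ (G.aug (Finsupp.single s 1))
    rw [← hy, ← map_smul]
    exact (Submodule.Quotient.mk_eq_zero _).2 (Ideal.mul_mem_right y _ hmem)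
  · rw [G.aug_homogeneous s hs, smul_zero]

/-- The differential commutes with the projections, so any preimage may be replaced by its component
of degree `j`. -/
theorem exists_homVec_d_eq {i : ℕ} {j : ℤ} {f : G.ι i →₀ A} (hf : G.HomVec (intPart 𝒜) i j f)
    (h : ∃ g, G.d i g = f) : ∃ g, G.HomVec (intPart 𝒜) (i + 1) j g ∧ G.d i g = f := by
  obtain ⟨g, rfl⟩ := h
  exact ⟨freeProj 𝒜 (G.deg (i + 1)) j g, freeProj_mem 𝒜 _ _ _, by
    rw [freeProj_map (G.d i) (G.d_homogeneous i), freeProj_same 𝒜 hf]⟩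

theorem vanishAbove_top_zero (J : Ideal A) : G.VanishAbove (intPart 𝒜) J ⊤ 0 0 := by
  intro j hj f _ hf _
  obtain ⟨g, hg, rfl⟩ := G.exists_homVec_d_eq hf ((G.exact_aug f).1 (G.aug_eq_zero hj hf))
  exact ⟨g, fun _ => trivial, hg, fun s => by rw [vecD_self, sub_self]; exact zero_mem _⟩

/-- This is the connecting map for `0 → J → A → A/J → 0`: a cycle modulo `J` has its differential in
`J`, where it bounds some `k`; then `f - k` is a genuine cycle, and `G` is exact there. -/
theorem vanishAbove_top_succ {J : Ideal A} {i : ℕ} {b : ℤ}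
    (h : G.VanishAbove (intPart 𝒜) ⊥ J i b) : G.VanishAbove (intPart 𝒜) J ⊤ (i + 1) b := by
  intro j hj f _ hf hcyc
  have hc : G.CycleMod ⊥ i (G.vecD A i f) := by
    cases i with
    | zero => trivial
    | succ i => intro s; rw [vecD_vecD]; exact zero_mem _
  obtain ⟨k, hkJ, hk, hkf⟩ := h j hj (G.vecD A i f) hcyc
    (G.homVec_vecD (isGradedProj_projZ 𝒜) hf) hc
  have h0 : G.d i (f - k) = 0 := by
    rw [map_sub, ← vecD_self]
    ext s
    exact (Submodule.mem_bot A).1 (hkf s)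
  obtain ⟨g, hg, hgf⟩ := G.exists_homVec_d_eq (f := f - k) (j := j)
    (fun s => sub_mem (hf s) (hk s)) ((G.exact_d i _).1 h0)
  refine ⟨g, fun _ => trivial, hg, fun s => ?_⟩
  rw [vecD_self, hgf, sub_sub_cancel]
  exact hkJ s

theorem vanishAbove_bot (ℳ : ℤ → Submodule K M) (i : ℕ) (b : ℤ) :
    G.VanishAbove ℳ (⊥ : Submodule A M) ⊥ i b := fun j _ f hf _ _ =>
  ⟨0, fun _ => zero_mem _, fun _ => zero_mem _, fun s => by simpa using hf s⟩

/-- Extension by a cyclic module. -/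
theorem vanishAbove_sup_span {ℳ : ℤ → Submodule K M} {pr : ℤ → M →ₗ[K] M}
    (h : IsGradedProj 𝒜 ℳ pr) {N : Submodule A M} (hN : ∀ e, ∀ u ∈ N, pr e u ∈ N) {x : M} {c : ℤ}
    (hx : x ∈ ℳ c) {J : Ideal A} (hJ : ∀ a, a • x ∈ N ↔ a ∈ J) {i : ℕ} {b : ℤ}
    (h₁ : G.VanishAbove ℳ ⊥ N i b) (h₂ : G.VanishAbove (intPart 𝒜) J ⊤ i (b - c)) :
    G.VanishAbove ℳ ⊥ (N ⊔ Submodule.span A {x}) i b := by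
  intro j hj f hfL hf hcyc
  -- Any expression of `f s` as an element of `N` plus a multiple of `x` can be made homogeneous by
  -- projecting, since `N` is graded.
  have hcoeff : ∀ s, ∃ a ∈ intPart 𝒜 (j - c - G.deg i s), f s - a • x ∈ N := by
    intro s
    obtain ⟨n, hn, y, hy, hny⟩ := Submodule.mem_sup.1 (hfL s)
    obtain ⟨a, rfl⟩ := Submodule.mem_span_singleton.1 hy
    refine ⟨projZ 𝒜 (j - G.deg i s - c) a, ?_, ?_⟩
    · rw [show j - c - G.deg i s = j - G.deg i s - c by ring]
      exact projZ_mem 𝒜 _ _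
    · have := hN (j - G.deg i s) n hn
      rwa [eq_sub_of_add_eq hny, map_sub, h.same _ _ (hf s), h.proj_smul hx] at this
  choose a₀ ha₀ hfa₀ using hcoeff
  classical
  -- The chosen coefficients may be nonzero where `f` vanishes; they are cut off to keep the support
  -- finite.
  let a : G.ι i →₀ A := Finsupp.onFinset f.support (fun s => if f s = 0 then 0 else a₀ s)
    fun s hs => by
      rw [Finsupp.mem_support_iff]
      rintro h0
      simp [h0] at hs
  have ha : G.HomVec (intPart 𝒜) i (j - c) a := by
    intro s
    simp only [a, Finsupp.onFinset_apply]
    split_ifs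
    · exact zero_mem _
    · exact ha₀ s
  have hfa : ∀ s, (f - Finsupp.smulVec x a) s ∈ N := by
    intro s
    simp only [a, Finsupp.sub_apply, Finsupp.smulVec_apply, Finsupp.onFinset_apply]
    split_ifs with h0
    · simp [h0]
    · exact hfa₀ s
  -- The differential of `f` is zero, so that of `a • x` lies in `N`; as `J` is the annihilator of
  -- `x` modulo `N`, the differential of `a` lies in `J`.
  have hacyc : G.CycleMod J i a := by
    cases i with
    | zero => trivial
    | succ i =>
      intro s
      rw [← hJ, vecD_self, ← Finsupp.smulVec_apply, ← vecD_smulVec]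
      have h1 := G.vecD_mem hfa s
      rw [map_sub, Finsupp.sub_apply, (Submodule.mem_bot A).1 (hcyc s), zero_sub] at h1
      simpa using h1
  obtain ⟨g, -, hg, hgJ⟩ := h₂ (j - c) (by omega) a (fun _ => trivial) ha hacyc
  have hgx : G.HomVec ℳ (i + 1) j (Finsupp.smulVec x g) := fun s => by
    rw [Finsupp.smulVec_apply]
    have := h.smul_mem_of_intPart (hg s) hx
    rwa [show j - c - G.deg (i + 1) s + c = j - G.deg (i + 1) s by ring] at this
  have hrest : ∀ s, (f - G.vecD M i (Finsupp.smulVec x g)) s ∈ N := by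
    intro s
    have h1 := add_mem (hfa s) ((hJ _).2 (hgJ s))
    rw [← Finsupp.smulVec_apply, map_sub, vecD_self] at h1
    rw [vecD_smulVec]
    simpa using h1
  -- After subtracting the boundary of `g • x`, what is left of `f` is a cycle over `N`.
  obtain ⟨k, hkN, hk, hkf⟩ := h₁ j hj _ hrest
    (fun s => sub_mem (hf s) (G.homVec_vecD h hgx s)) (hcyc.sub_vecD G _)
  refine ⟨Finsupp.smulVec x g + k, fun s => ?_, fun s => add_mem (hgx s) (hk s), fun s => ?_⟩
  · rw [Finsupp.add_apply, Finsupp.smulVec_apply]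
    exact add_mem (Submodule.mem_sup_right (Submodule.smul_mem _ _
      (Submodule.mem_span_singleton_self x))) (Submodule.mem_sup_left (hkN s))
  · rw [map_add, ← sub_sub]
    exact hkf s

/-! ### From homogeneous vectors back to Betti numbers. -/

theorem homVec_of_mem_tensorPart [IsScalarTower K A M] {ℳ : ℤ → Submodule K M} {pr : ℤ → M →ₗ[K] M}
    (h : IsGradedProj 𝒜 ℳ pr) {i : ℕ} {j : ℤ} {t : M ⊗[A] (G.ι i →₀ A)}
    (ht : t ∈ G.tensorPart ℳ i j) : G.HomVec ℳ i j (tensorVec A M _ t) := by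
  induction ht using Submodule.span_induction with
  | mem t ht =>
    obtain ⟨a, b, rfl, x, hx, g, hg, rfl⟩ := ht
    intro s
    rw [tensorVec_tmul, Finsupp.smulVec_apply]
    have := h.smul_mem_of_intPart (hg s) hx
    rwa [show b - G.deg i s + a = a + b - G.deg i s by ring] at this
  | zero => intro s; simp
  | add t t' _ _ ht ht' => intro s; rw [map_add]; exact add_mem (ht s) (ht' s)
  | smul r t _ ht =>
    intro s
    rw [← algebraMap_smul A r t, map_smul, Finsupp.smul_apply, algebraMap_smul]
    exact Submodule.smul_mem _ _ (ht s)

theorem mem_tensorPart_of_homVec [IsScalarTower K A M] {ℳ : ℤ → Submodule K M} {i : ℕ} {j : ℤ} {f : G.ι i →₀ M}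
    (hf : G.HomVec ℳ i j f) : (tensorVec A M _).symm f ∈ G.tensorPart ℳ i j := by
  rw [← f.sum_single, map_finsuppSum]
  refine Submodule.sum_mem _ fun s _ => ?_
  change (tensorVec A M _).symm (Finsupp.single s (f s)) ∈ _
  rw [tensorVec_symm_single]
  refine Submodule.subset_span ⟨j - G.deg i s, G.deg i s, by ring, f s, hf s, _, ?_, rfl⟩
  have := single_mem_freePart 𝒜 (G.deg i) s (SetLike.one_mem_graded 𝒜)
  simpa using this

theorem betti_eq_zero [IsScalarTower K A M] {ℳ : ℤ → Submodule K M} {pr : ℤ → M →ₗ[K] M} (h : IsGradedProj 𝒜 ℳ pr)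
    {i : ℕ} {b j : ℤ} (hv : G.VanishAbove ℳ (⊥ : Submodule A M) ⊤ i b) (hj : b < j) :
    G.betti ℳ i j = 0 := by
  have key : (((G.tensorPart ℳ (i + 1) j).map (G.tensorD M i)).comap
      (G.cycles M i ⊓ G.tensorPart ℳ i j).subtype) = ⊤ := by
    rw [eq_top_iff]
    rintro ⟨t, htc, htp⟩ -
    have hc : G.CycleMod ⊥ i (tensorVec A M _ t) := by
      cases i with
      | zero => trivial
      | succ i =>
        intro s
        have h0 : (G.d i).lTensor M t = 0 := htc
        rw [vecD_tensorVec, h0, map_zero]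
        exact zero_mem _
    obtain ⟨g, -, hg, hgt⟩ := hv j hj _ (fun _ => trivial) (G.homVec_of_mem_tensorPart h htp) hc
    refine ⟨(tensorVec A M _).symm g, G.mem_tensorPart_of_homVec hg, ?_⟩
    apply (tensorVec A M _).injective
    have h1 := G.vecD_tensorVec i ((tensorVec A M _).symm g)
    rw [LinearEquiv.apply_symm_apply] at h1
    refine h1.symm.trans ?_
    ext s
    exact (sub_eq_zero.1 ((Submodule.mem_bot A).1 (hgt s))).symm
  have : Subsingleton (G.Tor ℳ i j) := Submodule.Quotient.subsingleton_iff.2 key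
  exact rank_subsingleton' K _

end GradedFreeResolution

end Strands

/-! ### Standard monomials and poset ideals. -/

section Straightening

set_option linter.unusedSectionVars false

variable {K A P : Type*} [Field K] [CommRing A] [Algebra K A] [PartialOrder P]

/-- The multichain obtained by putting an element in front. -/
def Multichain.cons (α : P) (c : Multichain P) (h : ∀ β, c.1.head? = some β → α ≤ β) :
    Multichain P :=
  ⟨α :: c.1, by
    obtain ⟨l, hl⟩ := c
    cases l with
    | nil => simp
    | cons β l =>
      have hβ : α ≤ β := h β rfl
      refine List.pairwise_cons.2 ⟨fun γ hγ => ?_, hl⟩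
      rcases List.mem_cons.1 hγ with rfl | hγ
      · exact hβ
      · exact hβ.trans ((List.pairwise_cons.1 hl).1 γ hγ)⟩

theorem stdMonomial_cons (φ : P → A) (α : P) (c : Multichain P)
    (h : ∀ β, c.1.head? = some β → α ≤ β) :
    stdMonomial φ (c.cons α h) = φ α * stdMonomial φ c := by
  simp [stdMonomial, Multichain.cons]

/-- A standard monomial is divisible by its first factor. -/
theorem exists_stdMonomial_eq_mul (φ : P → A) {c : Multichain P} {γ : P}
    (h : c.1.head? = some γ) : ∃ a, stdMonomial φ c = a * φ γ := by
  obtain ⟨l, hl⟩ := c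
  cases l with
  | nil => simp at h
  | cons β l =>
    obtain rfl : β = γ := by simpa using h
    exact ⟨(l.map φ).prod, by simp [stdMonomial, mul_comm]⟩

/-- The ideal generated by a poset ideal. -/
def posetIdeal (φ : P → A) (I : LowerSet P) : Ideal A := Ideal.span (φ '' I)

/-- The straightening condition for modules, without the requirement that the module is generated
by the poset. -/
structure IsStraightened (K : Type*) {A M P Q : Type*} [Field K] [CommRing A] [AddCommGroup M]
    [Module K M] [Module A M] [PartialOrder P] [PartialOrder Q]
    (φ : P → A) (ψ : Q → M) (I : Q → LowerSet P) : Prop where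
  linearIndependent : LinearIndependent K (stdElement φ ψ I)
  smul_mem : ∀ x : Q, ∀ α ∈ I x, φ α • ψ x ∈ Submodule.span A (ψ '' {y | y < x})

variable {M Q : Type*} [AddCommGroup M] [Module K M] [Module A M] [IsScalarTower K A M]
  [PartialOrder Q]

/-- Poset ideals generate modules with straightening laws. -/
theorem IsASL.isStraightened_lowerSet {𝒜 : ℕ → Submodule K A} [GradedAlgebra 𝒜] [Finite P]
    {φ : P → A} (hA : IsASL 𝒜 φ) (I : LowerSet P) :
    IsStraightened K φ (fun x : {p // p ∈ I} => φ x)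
      (fun x => ⟨{β | ¬ (x : P) ≤ β}, fun _ _ hab ha hb => ha (hb.trans hab)⟩) where
  linearIndependent := by
    set J : {p // p ∈ I} → LowerSet P :=
      fun x => ⟨{β | ¬ (x : P) ≤ β}, fun _ _ hab ha hb => ha (hb.trans hab)⟩
    have hle : ∀ z : StdIndex J, ∀ β, z.1.2.1.head? = some β → (z.1.1 : P) ≤ β := fun z β hβ =>
      not_not.1 (z.2 β hβ)
    have hinj : Function.Injective fun z : StdIndex J => z.1.2.cons (z.1.1 : P) (hle z) := by
      rintro ⟨⟨x, c⟩, hz⟩ ⟨⟨x', c'⟩, hz'⟩ h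
      have h1 := congrArg Subtype.val h
      simp only [Multichain.cons, List.cons.injEq] at h1
      exact Subtype.ext (Prod.ext (Subtype.ext h1.1) (Subtype.ext h1.2))
    -- The standard elements of the ideal are exactly standard monomials of `A`, with the generator
    -- `x` as first factor.
    have heq : stdElement φ (fun x : {p // p ∈ I} => φ x) J =
        stdMonomial φ ∘ fun z : StdIndex J => z.1.2.cons (z.1.1 : P) (hle z) := by
      funext z
      simp only [Function.comp, stdMonomial_cons, stdElement, smul_eq_mul, mul_comm]
    rw [heq]
    exact hA.linearIndependent.comp _ hinj
  smul_mem := by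
    rintro ⟨x, hx⟩ β (hβ : ¬ x ≤ β)
    rw [smul_eq_mul]
    -- If `β < x`, the factor `φ β` is itself a smaller generator. Otherwise the two are
    -- incomparable, and each term of the straightened product is divisible by some `γ < x`.
    by_cases hβx : β ≤ x
    · have hlt : β < x := lt_of_le_not_ge hβx hβ
      rw [mul_comm]
      exact Submodule.smul_mem _ (φ x) (Submodule.subset_span
        ⟨⟨β, I.lower hβx hx⟩, hlt, rfl⟩)
    · have hmem : φ x * φ β ∈ Submodule.span K (Set.range (stdMonomial φ)) := by
        rw [hA.span_eq_top]; trivial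
      obtain ⟨r, hr⟩ := Finsupp.mem_span_range_iff_exists_finsupp.1 hmem
      rw [mul_comm, ← hr]
      refine Submodule.sum_mem _ fun c hc => ?_
      obtain ⟨γ, hγ, hγx, -⟩ := hA.straightening x β hβ hβx r hr.symm c hc
      obtain ⟨a, ha⟩ := exists_stdMonomial_eq_mul φ hγ
      simp only [ha, ← smul_mul_assoc]
      exact Submodule.smul_mem _ _ (Submodule.subset_span
        ⟨⟨γ, I.lower hγx.le hx⟩, hγx, rfl⟩)

/-- To show that an `A`-span lies in a `K`-subspace, it is enough to consider the multiples of the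
generators. -/
theorem span_subset_of_forall_smul_mem {S : Set M} {W : Submodule K M}
    (h : ∀ x ∈ S, ∀ a : A, a • x ∈ W) {u : M} (hu : u ∈ Submodule.span A S) : u ∈ W := by
  suffices H : ∀ a : A, a • u ∈ W by simpa using H 1
  induction hu using Submodule.span_induction with
  | mem x hx => exact h x hx
  | zero => simp
  | add x y _ _ hx hy => intro a; rw [smul_add]; exact add_mem (hx a) (hy a)
  | smul r x _ hx => intro a; rw [smul_smul]; exact hx _

/-! ### Cyclic quotients of the filtration by lower sets. -/

namespace IsStraightened

variable {φ : P → A} {ψ : Q → M} {I : Q → LowerSet P}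

/-- Modulo smaller elements, `A x` is spanned by the standard elements. -/
theorem exists_decomposition (hspan : Submodule.span K (Set.range (stdMonomial φ)) = ⊤)
    (J : LowerSet P) (a : A) :
    ∃ a₁ ∈ Submodule.span K (stdMonomial φ '' {c | ∀ α, c.1.head? = some α → α ∉ J}),
      ∃ a₂ ∈ posetIdeal φ J, a = a₁ + a₂ := by
  have ha : a ∈ Submodule.span K (Set.range (stdMonomial φ)) := by rw [hspan]; trivial
  induction ha using Submodule.span_induction with
  | mem a ha =>
    obtain ⟨c, rfl⟩ := ha
    by_cases hc : ∀ α, c.1.head? = some α → α ∉ J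
    · exact ⟨_, Submodule.subset_span ⟨c, hc, rfl⟩, 0, zero_mem _, (add_zero _).symm⟩
    · push Not at hc
      obtain ⟨α, hα, hαJ⟩ := hc
      obtain ⟨b, hb⟩ := exists_stdMonomial_eq_mul φ hα
      refine ⟨0, zero_mem _, _, ?_, (zero_add _).symm⟩
      rw [hb]
      exact Ideal.mul_mem_left _ _ (Ideal.subset_span ⟨α, hαJ, rfl⟩)
  | zero => exact ⟨0, zero_mem _, 0, zero_mem _, (add_zero _).symm⟩
  | add a b _ _ ha hb =>
    obtain ⟨a₁, ha₁, a₂, ha₂, rfl⟩ := ha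
    obtain ⟨b₁, hb₁, b₂, hb₂, rfl⟩ := hb
    exact ⟨_, add_mem ha₁ hb₁, _, add_mem ha₂ hb₂, by ring⟩
  | smul r a _ ha =>
    obtain ⟨a₁, ha₁, a₂, ha₂, rfl⟩ := ha
    refine ⟨_, Submodule.smul_mem _ r ha₁, _, ?_, smul_add r a₁ a₂⟩
    rw [← algebraMap_smul A r a₂]
    exact Submodule.smul_mem _ _ ha₂

theorem posetIdeal_smul_mem (h : IsStraightened K φ ψ I) (x : Q) {a : A}
    (ha : a ∈ posetIdeal φ (I x)) : a • ψ x ∈ Submodule.span A (ψ '' {y | y < x}) := by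
  have : posetIdeal φ (I x) ≤
      (Submodule.span A (ψ '' {y | y < x})).comap (LinearMap.toSpanSingleton A M (ψ x)) := by
    refine Ideal.span_le.2 ?_
    rintro _ ⟨α, hα, rfl⟩
    exact h.smul_mem x α hα
  exact this ha

theorem stdMonomial_smul_mem_span (x : Q) {a : A}
    (ha : a ∈ Submodule.span K (stdMonomial φ '' {c | ∀ α, c.1.head? = some α → α ∉ I x})) :
    a • ψ x ∈ Submodule.span K (stdElement φ ψ I '' {z | z.1.1 = x}) := by
  induction ha using Submodule.span_induction with
  | mem a ha =>
    obtain ⟨c, hc, rfl⟩ := ha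
    exact Submodule.subset_span ⟨⟨(x, c), hc⟩, rfl, rfl⟩
  | zero => simp
  | add a b _ _ ha hb => rw [add_smul]; exact add_mem ha hb
  | smul r a _ ha => rw [smul_assoc]; exact Submodule.smul_mem _ _ ha

theorem linearIndepOn_stdMonomial_smul (h : IsStraightened K φ ψ I) (x : Q) :
    LinearIndepOn K (fun c : Multichain P => stdMonomial φ c • ψ x)
      {c | ∀ α, c.1.head? = some α → α ∉ I x} := by
  let e : {c : Multichain P | ∀ α, c.1.head? = some α → α ∉ I x} → StdIndex I :=
    fun c => ⟨(x, c.1), c.2⟩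
  have he : Function.Injective e := by
    rintro ⟨c, hc⟩ ⟨c', hc'⟩ h
    simpa [e] using h
  exact h.linearIndependent.comp e he

variable [Finite Q]

/-- Splitting `a` modulo the ideal of `x` leaves a combination of standard elements over `x` and an
element generated strictly below `x`, to which well-founded induction applies. -/
theorem smul_mem_span_le (hspan : Submodule.span K (Set.range (stdMonomial φ)) = ⊤)
    (h : IsStraightened K φ ψ I) (x : Q) (a : A) :
    a • ψ x ∈ Submodule.span K (stdElement φ ψ I '' {z | z.1.1 ≤ x}) := by
  induction x using WellFoundedLT.induction generalizing a with
  | ind x ih =>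
    obtain ⟨a₁, ha₁, a₂, ha₂, rfl⟩ := exists_decomposition hspan (I x) a
    rw [add_smul]
    refine add_mem ?_ ?_
    · exact Submodule.span_mono (Set.image_mono fun z hz => le_of_eq hz)
        (stdMonomial_smul_mem_span x ha₁)
    · refine span_subset_of_forall_smul_mem ?_ (h.posetIdeal_smul_mem x ha₂)
      rintro _ ⟨y, hy, rfl⟩ b
      exact Submodule.span_mono (Set.image_mono fun z hz => le_trans hz (le_of_lt hy))
        (ih y hy b)

theorem mem_span_of_mem_span (hspan : Submodule.span K (Set.range (stdMonomial φ)) = ⊤)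
    (h : IsStraightened K φ ψ I) {S : Set Q} (hS : IsLowerSet S) {u : M}
    (hu : u ∈ Submodule.span A (ψ '' S)) :
    u ∈ Submodule.span K (stdElement φ ψ I '' {z : StdIndex I | z.1.1 ∈ S}) := by
  refine span_subset_of_forall_smul_mem ?_ hu
  rintro _ ⟨y, hy, rfl⟩ b
  have hsub : {z : StdIndex I | z.1.1 ≤ y} ⊆ {z | z.1.1 ∈ S} := by
    intro z hz
    rw [Set.mem_ofPred_eq] at hz ⊢
    exact hS hz hy
  exact Submodule.span_mono (Set.image_mono hsub) (h.smul_mem_span_le hspan y b)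

/-- The annihilator of `x` modulo smaller elements. -/
theorem smul_mem_span_iff (hspan : Submodule.span K (Set.range (stdMonomial φ)) = ⊤)
    (h : IsStraightened K φ ψ I) {S : Set Q} (hS : IsLowerSet S) {x : Q} (hx : x ∉ S)
    (hxS : {y | y < x} ⊆ S) (a : A) :
    a • ψ x ∈ Submodule.span A (ψ '' S) ↔ a ∈ posetIdeal φ (I x) := by
  have hJ : ∀ b ∈ posetIdeal φ (I x), b • ψ x ∈ Submodule.span A (ψ '' S) := fun b hb =>
    Submodule.span_mono (Set.image_mono hxS) (h.posetIdeal_smul_mem x hb)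
  refine ⟨fun ha => ?_, hJ a⟩
  obtain ⟨a₁, ha₁, a₂, ha₂, rfl⟩ := exists_decomposition hspan (I x) a
  rw [add_smul] at ha
  -- The standard part `a₁ • ψ x` is thus spanned both by standard elements over `x` and by those
  -- over `S`. Independence makes it zero, and then `a₁` itself is zero.
  have h₁ := h.mem_span_of_mem_span hspan hS ((add_mem_cancel_right (hJ a₂ ha₂)).1 ha)
  have hdisj : Disjoint {z : StdIndex I | z.1.1 = x} {z | z.1.1 ∈ S} :=
    Set.disjoint_left.2 fun z hz hz' => by
      rw [Set.mem_ofPred_eq] at hz hz'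
      exact hx (hz ▸ hz')
  have h0 : a₁ • ψ x = 0 := Submodule.disjoint_def.1
    (h.linearIndependent.disjoint_span_image hdisj) _ (stdMonomial_smul_mem_span x ha₁) h₁
  obtain ⟨r, hr, rfl⟩ := (Finsupp.mem_span_image_iff_linearCombination K).1 ha₁
  have hli := h.linearIndepOn_stdMonomial_smul x
  have hr0 : r = 0 := by
    refine linearIndepOn_iff.1 hli r hr ?_
    rw [← h0]
    simp only [Finsupp.linearCombination_apply, Finsupp.sum, Finset.sum_smul, smul_assoc]
  rw [hr0, map_zero, zero_add]
  exact ha₂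

end IsStraightened

end Straightening

/-! ### The degree bounds. -/

section Main

variable {K : Type*} {A : Type u} [Field K] [CommRing A] [Algebra K A]
variable {𝒜 : ℕ → Submodule K A} [GradedAlgebra 𝒜] {P : Type*} [PartialOrder P]
variable {M : Type v} [AddCommGroup M] [Module K M] [Module A M] [IsScalarTower K A M]
variable {Q : Type*} [PartialOrder Q] [Finite Q]

/-- The filtration of a module with straightening laws by cyclic modules bounds its `Tor`. -/
theorem IsStraightened.vanishAbove {φ : P → A} {ψ : Q → M} {I : Q → LowerSet P}
    (h : IsStraightened K φ ψ I) (hspan : Submodule.span K (Set.range (stdMonomial φ)) = ⊤)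
    {ℳ : ℤ → Submodule K M} {pr : ℤ → M →ₗ[K] M} (hpr : IsGradedProj 𝒜 ℳ pr)
    {degQ : Q → ℤ} (hdeg : ∀ q, ψ q ∈ ℳ (degQ q)) {m : ℤ} (hm : ∀ q, degQ q ≤ m)
    (G : GradedFreeResolution.{u, w} 𝒜) {i : ℕ} {b : ℤ}
    (hG : ∀ J : LowerSet P, G.VanishAbove (intPart 𝒜) (posetIdeal φ J) ⊤ i b)
    (S : Finset Q) (hS : IsLowerSet (S : Set Q)) :
    G.VanishAbove ℳ ⊥ (Submodule.span A (ψ '' S)) i (b + m) := by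
  classical
  induction hn : S.card generalizing S with
  | zero =>
    rw [Finset.card_eq_zero.1 hn]
    simpa using G.vanishAbove_bot ℳ i (b + m)
  | succ n ih =>
    obtain ⟨x, hxS, hx⟩ := S.exists_maximal (Finset.card_pos.1 (by omega))
    have hlow : IsLowerSet ((S.erase x : Finset Q) : Set Q) := by
      intro y z hzy hy
      simp only [Finset.coe_erase, Set.mem_sdiff, Set.mem_singleton_iff, Finset.mem_coe] at hy ⊢
      refine ⟨hS hzy hy.1, ?_⟩
      rintro rfl
      exact hy.2 (le_antisymm (hx hy.1 hzy) hzy)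
    have h₁ := ih (S.erase x) hlow (by rw [Finset.card_erase_of_mem hxS]; omega)
    have hspanS : Submodule.span A (ψ '' S) =
        Submodule.span A (ψ '' (S.erase x : Finset Q)) ⊔ Submodule.span A {ψ x} := by
      rw [← Submodule.span_union, ← Set.image_singleton, ← Set.image_union]
      congr 2
      ext y
      by_cases hy : y = x <;> simp [hy, hxS]
    rw [hspanS]
    refine G.vanishAbove_sup_span hpr ?_ (hdeg x) (J := posetIdeal φ (I x)) ?_ h₁ ?_
    · intro e u hu
      refine hpr.proj_mem_span ?_ e hu
      rintro _ ⟨y, -, rfl⟩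
      exact ⟨_, hdeg y⟩
    · refine h.smul_mem_span_iff hspan hlow (by simp) fun y hy => ?_
      rw [Set.mem_ofPred_eq] at hy
      simpa using And.intro (hS hy.le hxS) hy.ne
    -- The cyclic quotient needs the bound `b + m - degQ x`, which is at least `b`.
    · intro j hj
      exact hG (I x) j (by have := hm x; omega)

/-- The induction on `i` must treat all poset ideals at once: filtering `J` brings in the quotients
of `A` by the poset ideals of its generators. -/
theorem IsASL.vanishAbove_posetIdeal [Finite P] {φ : P → A} (hA : IsASL 𝒜 φ) {degP : P → ℕ}
    (hdegP : ∀ p, φ p ∈ 𝒜 (degP p)) {d : ℕ} (hd : ∀ p, degP p ≤ d)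
    (G : GradedFreeResolution.{u, w} 𝒜) (i : ℕ) (J : LowerSet P) :
    G.VanishAbove (intPart 𝒜) (posetIdeal φ J) ⊤ i (i * d) := by
  classical
  induction i generalizing J with
  | zero => simpa using G.vanishAbove_top_zero (posetIdeal φ J)
  | succ i ih =>
    have := Fintype.ofFinite {p // p ∈ J}
    have h := (hA.isStraightened_lowerSet J).vanishAbove hA.span_eq_top (isGradedProj_projZ 𝒜)
      (degQ := fun p => (degP p : ℤ)) (fun p => hdegP p) (m := d) (fun p => by exact_mod_cast hd p)
      G ih Finset.univ (by simp [isLowerSet_univ])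
    have hJ : Submodule.span A ((fun x : {p // p ∈ J} => φ x) '' ↑(Finset.univ : Finset {p // p ∈ J})) =
        posetIdeal φ J := by
      rw [Finset.coe_univ, Set.image_univ, posetIdeal, Set.image_eq_range]
      rfl
    rw [hJ] at h
    have h' := G.vanishAbove_top_succ h
    -- The filtration of `J` gives `i * d + d`, with the last `d` bounding the generator degrees.
    convert h' using 1
    push_cast
    ring

end Main

theorem mainTheorem4 {K A M P Q : Type*} [Field K]
    -- the graded `K`-algebra `A`, an ASL on `P`
    [CommRing A] [Algebra K A] (𝒜 : ℕ → Submodule K A) [GradedAlgebra 𝒜]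
    [PartialOrder P] [Fintype P] (φ : P → A) (hA : IsASL 𝒜 φ)
    -- the graded `A`-module `M`, an MSL on `Q`
    [AddCommGroup M] [Module K M] [Module A M] [IsScalarTower K A M]
    (ℳ : ℤ → Submodule K M) [DirectSum.Decomposition ℳ]
    (hℳ : ∀ (a : ℕ) (b : ℤ), ∀ r ∈ 𝒜 a, ∀ x ∈ ℳ b, r • x ∈ ℳ (a + b))
    [PartialOrder Q] [Fintype Q] (ψ : Q → M) (hM : IsMSL K φ ψ)
    -- the degrees of the elements of `P` and `Q` and their maxima
    (degP : P → ℕ) (hdegP : ∀ p, φ p ∈ 𝒜 (degP p))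
    (degQ : Q → ℤ) (hdegQ : ∀ q, ψ q ∈ ℳ (degQ q))
    (d : ℕ) (hd : d = Finset.univ.sup degP)
    (m : ℤ) (hm : IsGreatest (Set.range degQ) m)
    -- `Tor` may be computed from any graded free resolution of `K`
    (G : GradedFreeResolution 𝒜) (i : ℕ) (j : ℤ)
    (hij : j - i ≥ i * ((d : ℤ) - 1) + m + 1) :
    G.betti ℳ i j = 0 := by
  obtain ⟨I, hli, hspan, hI⟩ := hM.exists_ideals
  obtain ⟨pr, hpr⟩ := exists_isGradedProj ℳ hℳ
  have hd' : ∀ p, degP p ≤ d := fun p => hd ▸ Finset.le_sup (Finset.mem_univ p)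
  have hv := IsStraightened.vanishAbove ⟨hli, hI⟩ hA.span_eq_top hpr hdegQ
    (fun q => hm.2 ⟨q, rfl⟩) G (fun J => hA.vanishAbove_posetIdeal hdegP hd' G i J)
    Finset.univ (by simp [isLowerSet_univ])
  have htop : Submodule.span A (ψ '' (Finset.univ : Finset Q)) = ⊤ := by
    rw [eq_top_iff]
    intro u _
    have hu : u ∈ Submodule.span K (Set.range (stdElement φ ψ I)) := by rw [hspan]; trivial
    refine (Submodule.span_le (p := (Submodule.span A _).restrictScalars K)).2 ?_ hu
    rintro _ ⟨z, rfl⟩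
    exact Submodule.smul_mem (Submodule.span A (ψ '' (Finset.univ : Finset Q))) _
      (Submodule.subset_span ⟨z.1.1, by simp, rfl⟩)
  rw [htop] at hv
  refine G.betti_eq_zero hpr hv ?_
  -- The bound supplied by `hv` is `i * d + m`; cancelling `i` in `hij` gives `j ≥ i * d + m + 1`.
  linarith
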